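/- Let $n,p$ be nonnegative integers, $X\in\mathbb{R}^{n\times p}$ with rows $x_i^\top$, $y\in\{0,1\}^n$ and $\zeta>0$ be fixed, and let $\pi_{\rm loc}$ be a probability density on $(0,\infty)$ with unbounded support, i.e. $\int_a^\infty\pi_{\rm loc}(\lambda)\,d\lambda>0$ for every $a>0$. Write $\mathcal N(\beta;\mu,\Sigma)$ for the density at $\beta\in\mathbb{R}^p$ of the Gaussian distribution with mean $\mu$ and covariance $\Sigma$. Given $\tau>0$ and $\beta^*\in\mathbb{R}^p$, consider the following cycle of the Pólya–Gamma Gibbs sampler for regularized sparse logistic regression with slab width $\zeta$ and fixed global scale $\tau$: 1. draw independent $\lambda_1,\dots,\lambda_p>0$ with densities $\pi(\lambda_j\mid\beta_j^*,\tau)\propto(\tau\lambda_j)^{-1}\exp\{-\beta_j^{*2}/(2\tau^2\lambda_j^2)\}\,\pi_{\rm loc}(\lambda_j)$; 2. draw independent $\omega_1,\dots,\omega_n$, where $\omega_i$ is Pólya–Gamma with shape $1$ and tilting $c_i=x_i^\top\beta^*$, i.e. distributed as $\frac1{2\pi^2}\sum_{k\ge1}g_k/\big((k-\frac12)^2+c_i^2/(4\pi^2)\big)$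 with $g_k$ independent standard exponential variables; 3. draw $\beta\sim\mathcal N\big(\Phi^{-1}X^\top(y-\tfrac12\mathbf 1),\Phi^{-1}\big)$ with $\Phi=X^\top\mathrm{diag}(\omega)X+\zeta^{-2}I+\tau^{-2}\mathrm{diag}(\lambda)^{-2}$. Let $P(\beta\mid\beta^*,\tau)\in[0,\infty]$ be the resulting transition density, that is, the density of step 3 at $\beta$ integrated over the laws of $\omega$ and $\lambda$. For $R>0$ put $\Phi_R=\frac12X^\top X+\zeta^{-2}I+R^{-2}I$ and $\mu_R=\Phi_R^{-1}X^\top(y-\frac12\mathbf 1)$. **Theorem (Minorization).** Let $\epsilon,R>0$. There is a function $\delta:(0,\infty)\to(0,\infty)$, increasing in $\tau$ and, for the fixed data $(n,p,X,y,\zeta)$, depending otherwise only on $\epsilon$, $R$ and $\pi_{\rm loc}$, such that for every $\tau>0$, every $\beta^*\in\mathbb{R}^p$ with $\min_j|\beta_j^*/\tau|\ge\epsilon$ and every $\beta\in\mathbb{R}^p$, $$P(\beta\mid\beta^*,\tau)\ \ge\ \delta(\tau)\,\mathcal N(\beta;\mu_R,\Phi_R^{-1}).$$ Moreover, if $\int_0^\infty\lambda^{-1}\pi_{\rm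 loc}(\lambda)\,d\lambda<\infty$, then there is a positive function $\delta(\tau)$, increasing in $\tau$ and, for the fixed data, depending otherwise only on $R$ and $\pi_{\rm loc}$, such that the same inequality holds for every $\tau>0$ and all $\beta^*,\beta\in\mathbb{R}^p$. -/

import Mathlib

open MeasureTheory ProbabilityTheory Matrix

noncomputable section

namespace SparseLogit

instance : IsProbabilityMeasure (expMeasure 1) := isProbabilityMeasure_expMeasure one_pos

/-- The random series `(2π²)⁻¹ ∑_{k ≥ 1} g_k / ((k - 1/2)² + c² / (4π²))`, indexed from `0`. -/
def polyaGammaSeries (c : ℝ) (g : ℕ → ℝ) : ℝ :=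
  (2 * Real.pi ^ 2)⁻¹ *
    ∑' k : ℕ, g k / (((k : ℝ) + 1 / 2) ^ 2 + c ^ 2 / (4 * Real.pi ^ 2))

/-- The Pólya–Gamma distribution with shape `1` and tilting `c`: the law of the series above
when the `g_k` are independent standard exponential random variables. -/
def polyaGamma (c : ℝ) : Measure ℝ :=
  (Measure.infinitePi (fun _ : ℕ => expMeasure 1)).map (polyaGammaSeries c)

lemma aemeasurable_polyaGammaSeries (c : ℝ) :
    AEMeasurable (polyaGammaSeries c) (Measure.infinitePi (fun _ : ℕ => expMeasure 1)) := by
  have hnn : ∀ᵐ x ∂(expMeasure 1), (0 : ℝ) ≤ x := by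
    rw [ae_iff]
    have h : {a : ℝ | ¬ 0 ≤ a} = Set.Iio 0 := by ext; simp
    rw [h, expMeasure, gammaMeasure, withDensity_apply _ measurableSet_Iio]
    exact lintegral_gammaPDF_of_nonpos le_rfl
  have hall : ∀ᵐ g ∂(Measure.infinitePi (fun _ : ℕ => expMeasure 1)), ∀ k, (0 : ℝ) ≤ g k := by
    rw [ae_all_iff]
    intro k
    exact (measurePreserving_eval_infinitePi (fun _ : ℕ => expMeasure 1) k).quasiMeasurePreserving.ae
      hnn
  refine ⟨fun g => (2 * Real.pi ^ 2)⁻¹ * (∑' k : ℕ, ENNReal.ofReal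
    (g k / (((k : ℝ) + 1 / 2) ^ 2 + c ^ 2 / (4 * Real.pi ^ 2)))).toReal, ?_, ?_⟩
  · have h : Measurable fun g : ℕ → ℝ => ∑' k : ℕ, ENNReal.ofReal
        (g k / (((k : ℝ) + 1 / 2) ^ 2 + c ^ 2 / (4 * Real.pi ^ 2))) := by
      refine Measurable.tsum fun k => ?_
      fun_prop
    exact h.ennreal_toReal.const_mul _
  · filter_upwards [hall] with g hg
    rw [polyaGammaSeries, ENNReal.tsum_toReal_eq (fun _ => ENNReal.ofReal_ne_top)]
    congr 1
    refine tsum_congr fun k => ?_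
    rw [ENNReal.toReal_ofReal]
    have := hg k
    positivity

instance (c : ℝ) : IsProbabilityMeasure (polyaGamma c) :=
  Measure.isProbabilityMeasure_map (aemeasurable_polyaGammaSeries c)

/-- The density at `x` of the Gaussian distribution on `ℝᵖ` with mean `m` and (positive definite)
covariance matrix `S`. -/
def gaussianDensity {p : ℕ} (m : Fin p → ℝ) (S : Matrix (Fin p) (Fin p) ℝ) (x : Fin p → ℝ) : ℝ :=
  (√((2 * Real.pi) ^ p * S.det))⁻¹ * Real.exp (-(1 / 2) * ((x - m) ⬝ᵥ (S⁻¹ *ᵥ (x - m))))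

/-- The vector `Xᵀ (y - 1/2)`. -/
def score {n p : ℕ} (X : Matrix (Fin n) (Fin p) ℝ) (y : Fin n → ℝ) : Fin p → ℝ :=
  Xᵀ *ᵥ (fun i => y i - 1 / 2)

/-- The precision matrix `Φ = Xᵀ Ω X + ζ⁻² I + τ⁻² Λ⁻²`. -/
def condPrecision {n p : ℕ} (X : Matrix (Fin n) (Fin p) ℝ) (ζ τ : ℝ) (ω : Fin n → ℝ)
    (l : Fin p → ℝ) : Matrix (Fin p) (Fin p) ℝ :=
  Xᵀ * diagonal ω * X + (ζ ^ 2)⁻¹ • (1 : Matrix (Fin p) (Fin p) ℝ)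
    + (τ ^ 2)⁻¹ • diagonal (fun j => (l j ^ 2)⁻¹)

/-- The conditional density of `β` given `ω, τ, λ, y, X, z = 0`: Gaussian with mean
`Φ⁻¹ Xᵀ (y - 1/2)` and covariance `Φ⁻¹`. -/
def regCoefCondDensity {n p : ℕ} (X : Matrix (Fin n) (Fin p) ℝ) (y : Fin n → ℝ) (ζ τ : ℝ)
    (ω : Fin n → ℝ) (l : Fin p → ℝ) (β : Fin p → ℝ) : ℝ :=
  gaussianDensity ((condPrecision X ζ τ ω l)⁻¹ *ᵥ score X y) (condPrecision X ζ τ ω l)⁻¹ β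

/-- The joint law of `ω` given `β*` and `X`: independent Pólya–Gamma variables with tiltings
`xᵢᵀ β*`. -/
def omegaCondMeasure {n p : ℕ} (X : Matrix (Fin n) (Fin p) ℝ) (βs : Fin p → ℝ) :
    Measure (Fin n → ℝ) :=
  Measure.pi (fun i => polyaGamma ((X *ᵥ βs) i))

/-- The transition density `P(β | β*, τ, λ) = ∫ π(β | ω, τ, λ, y, X, z = 0) π(dω | β*, X)`. -/
def kernelGivenScales {n p : ℕ} (X : Matrix (Fin n) (Fin p) ℝ) (y : Fin n → ℝ) (ζ τ : ℝ)
    (l βs β : Fin p → ℝ) : ENNReal :=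
  ∫⁻ ω, ENNReal.ofReal (regCoefCondDensity X y ζ τ ω l β) ∂(omegaCondMeasure X βs)

/-- The unnormalized conditional density of a local scale `λ > 0` given `β* = b` and `τ`:
`(τ λ)⁻¹ exp(-b² / (2 τ² λ²)) π_loc(λ)`. -/
def localScaleWeight (πloc : ℝ → ℝ) (b τ l : ℝ) : ℝ :=
  (τ * l)⁻¹ * Real.exp (-(b ^ 2 / (2 * τ ^ 2 * l ^ 2))) * πloc l

/-- The conditional density of a local scale `λ > 0` given `β* = b` and `τ`. -/
def localScaleCondDensity (πloc : ℝ → ℝ) (b τ l : ℝ) : ENNReal :=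
  ENNReal.ofReal (localScaleWeight πloc b τ l) /
    ∫⁻ u in Set.Ioi (0 : ℝ), ENNReal.ofReal (localScaleWeight πloc b τ u)

/-- The marginal transition density
`P(β | β*, τ) = ∫_{(0,∞)ᵖ} P(β | β*, τ, λ) ∏ⱼ π(λⱼ | βⱼ*, τ) dλ`, with values in `[0, ∞]`. -/
def marginalKernel {n p : ℕ} (X : Matrix (Fin n) (Fin p) ℝ) (y : Fin n → ℝ) (ζ : ℝ)
    (πloc : ℝ → ℝ) (τ : ℝ) (βs β : Fin p → ℝ) : ENNReal :=
  ∫⁻ l in Set.univ.pi (fun _ : Fin p => Set.Ioi (0 : ℝ)),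
    kernelGivenScales X y ζ τ l βs β * ∏ j, localScaleCondDensity πloc (βs j) τ (l j)

/-- `Φ_R = ½ Xᵀ X + ζ⁻² I + R⁻² I`. -/
def refPrecision {n p : ℕ} (X : Matrix (Fin n) (Fin p) ℝ) (ζ R : ℝ) :
    Matrix (Fin p) (Fin p) ℝ :=
  (1 / 2 : ℝ) • (Xᵀ * X) + (ζ ^ 2)⁻¹ • (1 : Matrix (Fin p) (Fin p) ℝ)
    + (R ^ 2)⁻¹ • (1 : Matrix (Fin p) (Fin p) ℝ)

/-- `μ_R = Φ_R⁻¹ Xᵀ (y - 1/2)`. -/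
def refMean {n p : ℕ} (X : Matrix (Fin n) (Fin p) ℝ) (y : Fin n → ℝ) (ζ R : ℝ) : Fin p → ℝ :=
  (refPrecision X ζ R)⁻¹ *ᵥ score X y

/-- `π_loc` is a probability density on `(0, ∞)`; its values elsewhere are irrelevant. -/
structure IsLocalScalePrior (πloc : ℝ → ℝ) : Prop where
  measurable : Measurable πloc
  nonneg : ∀ l, 0 < l → 0 ≤ πloc l
  lintegral_eq_one : ∫⁻ l in Set.Ioi (0 : ℝ), ENNReal.ofReal (πloc l) = 1

end SparseLogit

end

/-!
The minorization rests on three bounds that hold uniformly in the current state `β*`.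

* Tilting a Pólya–Gamma variable only makes it smaller, and the untilted variable has mean `1/4`.
  By Markov's inequality every `ωᵢ` lies in `[0, 1/2]` with probability at least `1/2`, whatever
  `β*` is (`half_le_polyaGamma_Icc`).
* If `0 ≤ ωᵢ ≤ 1/2` and `R ≤ τ λⱼ`, then `ζ⁻² I ≤ Φ ≤ Φ_R` in the Loewner order. Expanding the
  square, the density with precision `Φ` and mean `Φ⁻¹ s` is proportional to
  `(det Φ)^{1/2} exp(-βᵀΦβ / 2 + sᵀβ - sᵀΦ⁻¹s / 2)`. The upper bound on `Φ` controls the quadratic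
  term and the lower bound controls the determinant and `sᵀΦ⁻¹s`, so this density dominates a
  constant multiple of the reference density (`mul_gaussianDensity_le`).
* The conditional law of `λⱼ` depends on `β*ⱼ` and `τ` through `u = β*ⱼ / τ` only, and it is
  stochastically increasing in `|u|`, because the likelihood ratio is monotone in `λ`
  (`scaleTail_mono_left`). Hence `λⱼ > R / τ` has probability at least its value at the smallest
  admissible `|u|`. That is `ε` in the first half of the theorem, and `0` in the second, where
  integrability of `λ⁻¹ π_loc(λ)` is what makes the conditional law at `u = 0` normalizable. The
  value is positive as the support is unbounded, and nondecreasing in `τ`.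

Integrating the density bound over `ω ∈ [0, 1/2]ⁿ` and `λ ∈ (R / τ, ∞)ᵖ` gives
`exists_minorization`, of which both halves of the theorem are instances.
-/

namespace SparseLogit

/-! ### Pólya–Gamma variables are rarely large -/

lemma hasSum_inv_add_half_sq :
    HasSum (fun k : ℕ => (((k : ℝ) + 1 / 2) ^ 2)⁻¹) (Real.pi ^ 2 / 2) := by
  have hz := hasSum_zeta_two
  have heven : HasSum (fun k : ℕ => (1 : ℝ) / ((2 * k : ℕ) : ℝ) ^ 2)
      (1 / 4 * (Real.pi ^ 2 / 6)) := by
    have hfun : (fun k : ℕ => (1 : ℝ) / ((2 * k : ℕ) : ℝ) ^ 2)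
        = fun k : ℕ => 1 / 4 * ((1 : ℝ) / (k : ℝ) ^ 2) := by
      funext k
      push_cast
      rw [mul_pow, div_mul_div_comm]
      norm_num
    rw [hfun]
    exact hz.mul_left (1 / 4)
  have hodd : Summable fun k : ℕ => (1 : ℝ) / ((2 * k + 1 : ℕ) : ℝ) ^ 2 :=
    hz.summable.comp_injective (i := fun k : ℕ => 2 * k + 1) fun a b h => by
      simpa using h
  have hsum := (HasSum.even_add_odd (f := fun n : ℕ => (1 : ℝ) / (n : ℝ) ^ 2)
    heven hodd.hasSum).unique hz
  have hfun : (fun k : ℕ => (((k : ℝ) + 1 / 2) ^ 2)⁻¹)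
      = fun k : ℕ => 4 * ((1 : ℝ) / ((2 * k + 1 : ℕ) : ℝ) ^ 2) := by
    funext k
    have : (k : ℝ) + 1 / 2 = (2 * k + 1) / 2 := by ring
    push_cast
    rw [this, div_pow, inv_div]
    ring
  have hval : Real.pi ^ 2 / 2 = 4 * ∑' k : ℕ, (1 : ℝ) / ((2 * k + 1 : ℕ) : ℝ) ^ 2 := by
    linarith
  rw [hfun, hval]
  exact hodd.hasSum.mul_left 4

lemma ae_nonneg_expMeasure : ∀ᵐ x ∂(expMeasure 1), (0 : ℝ) ≤ x := by
  rw [ae_iff]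
  have h : {a : ℝ | ¬ 0 ≤ a} = Set.Iio 0 := by ext; simp
  rw [h, expMeasure, gammaMeasure, withDensity_apply _ measurableSet_Iio]
  exact lintegral_gammaPDF_of_nonpos le_rfl

/-- The standard exponential distribution has mean `1`: its density times `x` is the density of
the gamma distribution with shape `2`. -/
lemma lintegral_ofReal_expMeasure : ∫⁻ x, ENNReal.ofReal x ∂(expMeasure 1) = 1 := by
  rw [← lintegral_gammaPDF_eq_one (a := 2) (r := 1) two_pos one_pos, expMeasure, gammaMeasure,
    lintegral_withDensity_eq_lintegral_mul _ (by unfold gammaPDF; fun_prop) (by fun_prop)]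
  refine lintegral_congr fun x => ?_
  rcases lt_or_ge x 0 with hx | hx
  · simp [gammaPDF_of_neg hx]
  · rw [Pi.mul_apply, gammaPDF_of_nonneg hx, gammaPDF_of_nonneg hx,
      ← ENNReal.ofReal_mul (by simp; positivity)]
    congr 1
    norm_num [Real.Gamma_two]
    ring

/-- A Pólya–Gamma variable lies in `[0, 1/2]` with probability at least `1/2`, whatever its
tilting: tilting only decreases the terms of the series, the untilted variable has mean `1/4`, and
Markov's inequality applies. -/
lemma half_le_polyaGamma_Icc (c : ℝ) :
    (2 : ENNReal)⁻¹ ≤ polyaGamma c (Set.Icc 0 (1 / 2)) := by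
  set P := Measure.infinitePi (fun _ : ℕ => expMeasure 1)
  set S : (ℕ → ℝ) → ENNReal := fun g =>
    ∑' k : ℕ, ENNReal.ofReal ((2 * Real.pi ^ 2)⁻¹ * (((k : ℝ) + 1 / 2) ^ 2)⁻¹)
      * ENNReal.ofReal (g k) with hS
  have hSm : Measurable S := Measurable.tsum fun k => by fun_prop
  have hmean : ∫⁻ g, S g ∂P = ENNReal.ofReal (1 / 4) := by
    rw [hS, lintegral_tsum fun k => Measurable.aemeasurable (by fun_prop)]
    have hk : ∀ k : ℕ, ∫⁻ g : ℕ → ℝ, ENNReal.ofReal ((2 * Real.pi ^ 2)⁻¹ *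
        (((k : ℝ) + 1 / 2) ^ 2)⁻¹) * ENNReal.ofReal (g k) ∂P
        = ENNReal.ofReal ((2 * Real.pi ^ 2)⁻¹ * (((k : ℝ) + 1 / 2) ^ 2)⁻¹) := by
      intro k
      rw [lintegral_const_mul _ (by fun_prop),
        (measurePreserving_eval_infinitePi (fun _ : ℕ => expMeasure 1) k).lintegral_comp
          (f := fun x => ENNReal.ofReal x) (by fun_prop),
        lintegral_ofReal_expMeasure, mul_one]
    have hs := hasSum_inv_add_half_sq.mul_left (2 * Real.pi ^ 2)⁻¹
    rw [tsum_congr hk, ← ENNReal.ofReal_tsum_of_nonneg (fun k => by positivity) hs.summable,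
      hs.tsum_eq]
    congr 1
    have := Real.pi_ne_zero
    field_simp
    norm_num
  have hmarkov : P {g | ENNReal.ofReal (1 / 2) ≤ S g} ≤ 2⁻¹ := by
    refine (meas_ge_le_lintegral_div hSm.aemeasurable (by simp) (by simp)).trans ?_
    rw [hmean, ← ENNReal.ofReal_div_of_pos (by norm_num)]
    refine le_of_eq ?_
    rw [show (1 / 4 / (1 / 2) : ℝ) = 2⁻¹ by norm_num, ENNReal.ofReal_inv_of_pos two_pos]
    norm_num
  have hall : ∀ᵐ g ∂P, ∀ k, (0 : ℝ) ≤ g k := by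
    rw [ae_all_iff]
    intro k
    exact (measurePreserving_eval_infinitePi (fun _ : ℕ => expMeasure 1) k).quasiMeasurePreserving.ae
      ae_nonneg_expMeasure
  rw [polyaGamma, Measure.map_apply_of_aemeasurable (aemeasurable_polyaGammaSeries c)
    measurableSet_Icc]
  have hsub : ∀ᵐ g ∂P, g ∈ {g | ENNReal.ofReal (1 / 2) ≤ S g}ᶜ →
      g ∈ polyaGammaSeries c ⁻¹' Set.Icc 0 (1 / 2) := by
    filter_upwards [hall] with g hg hlt
    have hlt : S g < ENNReal.ofReal (1 / 2) := not_le.mp hlt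
    have hterm : ∀ k : ℕ, 0 ≤ g k / (((k : ℝ) + 1 / 2) ^ 2 + c ^ 2 / (4 * Real.pi ^ 2)) := by
      intro k
      have := hg k
      positivity
    have hnn : 0 ≤ polyaGammaSeries c g := mul_nonneg (by positivity) (tsum_nonneg hterm)
    refine ⟨hnn, ?_⟩
    have hle : ENNReal.ofReal (polyaGammaSeries c g) ≤ S g := by
      rw [polyaGammaSeries, ← tsum_mul_left]
      have hterm' : ∀ k : ℕ, 0 ≤ (2 * Real.pi ^ 2)⁻¹ *
          (g k / (((k : ℝ) + 1 / 2) ^ 2 + c ^ 2 / (4 * Real.pi ^ 2))) :=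
        fun k => mul_nonneg (by positivity) (hterm k)
      by_cases hsm : Summable fun k : ℕ => (2 * Real.pi ^ 2)⁻¹ *
          (g k / (((k : ℝ) + 1 / 2) ^ 2 + c ^ 2 / (4 * Real.pi ^ 2)))
      · rw [ENNReal.ofReal_tsum_of_nonneg hterm' hsm]
        refine ENNReal.tsum_le_tsum fun k => ?_
        rw [← ENNReal.ofReal_mul (by positivity)]
        refine ENNReal.ofReal_le_ofReal ?_
        rw [mul_assoc, inv_mul_eq_div (((k : ℝ) + 1 / 2) ^ 2)]
        gcongr
        · exact hg k
        · exact le_add_of_nonneg_right (by positivity)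
      · -- a divergent series has the value `0` by convention
        rw [tsum_eq_zero_of_not_summable hsm]
        simp
    exact ((ENNReal.ofReal_lt_ofReal_iff (by norm_num)).mp (hle.trans_lt hlt)).le
  calc (2 : ENNReal)⁻¹ = 1 - 2⁻¹ := ENNReal.one_sub_inv_two.symm
    _ ≤ 1 - P {g | ENNReal.ofReal (1 / 2) ≤ S g} := tsub_le_tsub_left hmarkov 1
    _ = P {g | ENNReal.ofReal (1 / 2) ≤ S g}ᶜ :=
        (prob_compl_eq_one_sub (measurableSet_le measurable_const hSm)).symm
    _ ≤ _ := measure_mono_ae hsub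

lemma half_pow_le_omegaCondMeasure {n p : ℕ} (X : Matrix (Fin n) (Fin p) ℝ) (βs : Fin p → ℝ) :
    (2 : ENNReal)⁻¹ ^ n ≤
      omegaCondMeasure X βs (Set.univ.pi fun _ => Set.Icc 0 (1 / 2)) := by
  rw [omegaCondMeasure, Measure.pi_pi]
  calc (2 : ENNReal)⁻¹ ^ n = ∏ _i : Fin n, (2 : ENNReal)⁻¹ := by simp
    _ ≤ _ := Finset.prod_le_prod' fun i _ => half_le_polyaGamma_Icc _

/-! ### Comparison of Gaussian densities -/

section Gaussian

variable {p : ℕ} {A B : Matrix (Fin p) (Fin p) ℝ} {c : ℝ}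

lemma posDef_of_mul_dotProduct_le (hA : A.IsHermitian) (hc : 0 < c)
    (h : ∀ x : Fin p → ℝ, c * (x ⬝ᵥ x) ≤ x ⬝ᵥ (A *ᵥ x)) : A.PosDef := by
  refine PosDef.of_dotProduct_mulVec_pos hA fun x hx => ?_
  rw [star_trivial]
  refine lt_of_lt_of_le (mul_pos hc ?_) (h x)
  simpa using dotProduct_star_self_pos_iff.mpr hx

lemma pow_le_det (hA : A.IsHermitian) (hc : 0 < c)
    (h : ∀ x : Fin p → ℝ, c * (x ⬝ᵥ x) ≤ x ⬝ᵥ (A *ᵥ x)) : c ^ p ≤ A.det := by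
  rw [hA.det_eq_prod_eigenvalues]
  calc c ^ p = ∏ _i : Fin p, c := by simp
    _ ≤ _ := Finset.prod_le_prod (fun _ _ => hc.le) fun i _ => ?_
  have h1 : (hA.eigenvectorBasis i : Fin p → ℝ) ⬝ᵥ (hA.eigenvectorBasis i : Fin p → ℝ) = 1 := by
    have := hA.eigenvectorBasis.orthonormal.1 i
    have h2 := EuclideanSpace.inner_eq_star_dotProduct (𝕜 := ℝ) (hA.eigenvectorBasis i)
      (hA.eigenvectorBasis i)
    rw [real_inner_self_eq_norm_sq, this, star_trivial] at h2
    simpa using h2.symm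
  have h3 := h (hA.eigenvectorBasis i)
  rw [h1, mul_one] at h3
  simpa [hA.eigenvalues_eq] using h3

lemma dotProduct_inv_mulVec_le (hA : A.IsHermitian) (hc : 0 < c)
    (h : ∀ x : Fin p → ℝ, c * (x ⬝ᵥ x) ≤ x ⬝ᵥ (A *ᵥ x)) (s : Fin p → ℝ) :
    s ⬝ᵥ (A⁻¹ *ᵥ s) ≤ s ⬝ᵥ s / c := by
  have hu := (posDef_of_mul_dotProduct_le hA hc h).isUnit
  set v := A⁻¹ *ᵥ s with hv
  have hs : A *ᵥ v = s := by
    rw [hv, mulVec_mulVec, Matrix.mul_nonsing_inv _ ((isUnit_iff_isUnit_det A).mp hu), one_mulVec]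
  have h1 := h v
  rw [hs, dotProduct_comm v s] at h1
  -- `0 ≤ |s - c v|²` and `c |v|² ≤ s ⬝ v`
  have h2 : 0 ≤ (s - c • v) ⬝ᵥ (s - c • v) := by
    simpa using dotProduct_star_self_nonneg (s - c • v)
  simp only [sub_dotProduct, dotProduct_sub, smul_dotProduct, dotProduct_smul, smul_eq_mul,
    dotProduct_comm v s] at h2
  rw [le_div_iff₀ hc]
  nlinarith

/-- The Gaussian density with precision matrix `A` and mean `A⁻¹ s`, with the square expanded. -/
lemma gaussianDensity_inv_mulVec (hA : A.PosDef) (s β : Fin p → ℝ) :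
    gaussianDensity (A⁻¹ *ᵥ s) A⁻¹ β = (√((2 * Real.pi) ^ p))⁻¹ * (√A.det *
      Real.exp (-(1 / 2) * (β ⬝ᵥ (A *ᵥ β)) + s ⬝ᵥ β - 1 / 2 * (s ⬝ᵥ (A⁻¹ *ᵥ s)))) := by
  have hu : IsUnit A.det := (isUnit_iff_isUnit_det A).mp hA.isUnit
  have hs : A *ᵥ (A⁻¹ *ᵥ s) = s := by
    rw [mulVec_mulVec, Matrix.mul_nonsing_inv _ hu, one_mulVec]
  have hT : Aᵀ = A := (conjTranspose_eq_transpose_of_trivial A).symm.trans hA.isHermitian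
  have hsym : (A⁻¹ *ᵥ s) ⬝ᵥ (A *ᵥ β) = s ⬝ᵥ β := by
    rw [dotProduct_mulVec, ← mulVec_transpose, hT, hs]
  rw [gaussianDensity, Matrix.nonsing_inv_nonsing_inv _ hu, Matrix.det_nonsing_inv,
    Ring.inverse_eq_inv', Real.sqrt_mul (by positivity), Real.sqrt_inv, mul_inv, inv_inv, mul_assoc]
  congr 3
  rw [mulVec_sub, hs, sub_dotProduct, dotProduct_sub, dotProduct_sub, hsym, dotProduct_comm β s,
    dotProduct_comm (A⁻¹ *ᵥ s) s]
  ring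

/-- If `c I ≤ A ≤ B` in the Loewner order, the Gaussian density with precision `A` and mean `A⁻¹ s`
dominates the one with precision `B` and mean `B⁻¹ s`, up to a constant that does not depend
on `A`. -/
lemma mul_gaussianDensity_le (hA : A.IsHermitian) (hB : B.IsHermitian) (hc : 0 < c)
    (h : ∀ x : Fin p → ℝ, c * (x ⬝ᵥ x) ≤ x ⬝ᵥ (A *ᵥ x))
    (hAB : ∀ x : Fin p → ℝ, x ⬝ᵥ (A *ᵥ x) ≤ x ⬝ᵥ (B *ᵥ x)) (s β : Fin p → ℝ) :
    √(c ^ p / B.det) * Real.exp (-(1 / 2) * (s ⬝ᵥ s / c)) * gaussianDensity (B⁻¹ *ᵥ s) B⁻¹ β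
      ≤ gaussianDensity (A⁻¹ *ᵥ s) A⁻¹ β := by
  have hAp := posDef_of_mul_dotProduct_le hA hc h
  have hBp := posDef_of_mul_dotProduct_le hB hc fun x => (h x).trans (hAB x)
  have hinv := hBp.inv.posSemidef.dotProduct_mulVec_nonneg s
  rw [star_trivial] at hinv
  rw [gaussianDensity_inv_mulVec hAp, gaussianDensity_inv_mulVec hBp]
  have hdet : √(c ^ p / B.det) * √B.det = √(c ^ p) := by
    rw [← Real.sqrt_mul (div_nonneg (by positivity) hBp.det_pos.le),
      div_mul_cancel₀ _ hBp.det_pos.ne']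
  calc _ = (√((2 * Real.pi) ^ p))⁻¹ * (√(c ^ p / B.det) * √B.det *
        Real.exp (-(1 / 2) * (s ⬝ᵥ s / c) +
          (-(1 / 2) * (β ⬝ᵥ (B *ᵥ β)) + s ⬝ᵥ β - 1 / 2 * (s ⬝ᵥ (B⁻¹ *ᵥ s))))) := by
        rw [Real.exp_add]; ring
    _ ≤ _ := by
        rw [hdet]
        gcongr
        · exact pow_le_det hA hc h
        · linarith [hAB β, dotProduct_inv_mulVec_le hA hc h s]

end Gaussian

/-! ### The conditional precision matrix -/

section Precision

variable {n p : ℕ} (X : Matrix (Fin n) (Fin p) ℝ) (y : Fin n → ℝ) (ζ τ R : ℝ)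
  (ω : Fin n → ℝ) (l : Fin p → ℝ)

lemma isHermitian_condPrecision : (condPrecision X ζ τ ω l).IsHermitian := by
  rw [IsHermitian, conjTranspose_eq_transpose_of_trivial]
  simp [condPrecision, transpose_mul, Matrix.mul_assoc]

lemma dotProduct_condPrecision_mulVec (x : Fin p → ℝ) :
    x ⬝ᵥ (condPrecision X ζ τ ω l *ᵥ x) = ∑ i, ω i * (X *ᵥ x) i ^ 2
      + (ζ ^ 2)⁻¹ * (x ⬝ᵥ x) + ∑ j, (τ ^ 2 * l j ^ 2)⁻¹ * x j ^ 2 := by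
  have h1 : x ⬝ᵥ ((Xᵀ * diagonal ω * X) *ᵥ x) = ∑ i, ω i * (X *ᵥ x) i ^ 2 := by
    rw [← mulVec_mulVec, ← mulVec_mulVec, dotProduct_mulVec, vecMul_transpose]
    simp only [dotProduct, mulVec_diagonal]
    exact Finset.sum_congr rfl fun i _ => by ring
  have h2 : x ⬝ᵥ (((τ ^ 2)⁻¹ • diagonal fun j => (l j ^ 2)⁻¹) *ᵥ x)
      = ∑ j, (τ ^ 2 * l j ^ 2)⁻¹ * x j ^ 2 := by
    rw [smul_mulVec, dotProduct_smul]
    simp only [dotProduct, mulVec_diagonal, smul_eq_mul, Finset.mul_sum, mul_inv]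
    exact Finset.sum_congr rfl fun i _ => by ring
  rw [condPrecision, add_mulVec, add_mulVec, dotProduct_add, dotProduct_add, h1, h2,
    smul_mulVec, one_mulVec, dotProduct_smul, smul_eq_mul]

lemma refPrecision_eq_condPrecision :
    refPrecision X ζ R = condPrecision X ζ R (fun _ => 1 / 2) fun _ => 1 := by
  have h : (diagonal fun _ => (1 / 2 : ℝ) : Matrix (Fin n) (Fin n) ℝ) = (1 / 2 : ℝ) • 1 := by
    rw [smul_one_eq_diagonal]
  rw [refPrecision, condPrecision, h]
  simp

/-- The constant lost when the conditional density of `β` is bounded below by the reference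
Gaussian density. -/
noncomputable def densityRatio : ℝ :=
  √(((ζ ^ 2)⁻¹) ^ p / (refPrecision X ζ R).det) *
    Real.exp (-(1 / 2) * (score X y ⬝ᵥ score X y / (ζ ^ 2)⁻¹))

variable {ζ τ R ω l}

lemma mul_dotProduct_le_condPrecision (hω : ∀ i, 0 ≤ ω i) (x : Fin p → ℝ) :
    (ζ ^ 2)⁻¹ * (x ⬝ᵥ x) ≤ x ⬝ᵥ (condPrecision X ζ τ ω l *ᵥ x) := by
  rw [dotProduct_condPrecision_mulVec]
  have h1 : 0 ≤ ∑ i, ω i * (X *ᵥ x) i ^ 2 :=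
    Finset.sum_nonneg fun i _ => mul_nonneg (hω i) (sq_nonneg _)
  have h2 : 0 ≤ ∑ j, (τ ^ 2 * l j ^ 2)⁻¹ * x j ^ 2 := Finset.sum_nonneg fun j _ => by positivity
  linarith

lemma densityRatio_pos (hζ : 0 < ζ) : 0 < densityRatio X y ζ R := by
  have hdet : 0 < (refPrecision X ζ R).det := by
    rw [refPrecision_eq_condPrecision]
    exact (posDef_of_mul_dotProduct_le (isHermitian_condPrecision ..)
      (inv_pos.mpr (pow_pos hζ 2))
      (mul_dotProduct_le_condPrecision X fun _ => by norm_num)).det_pos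
  unfold densityRatio
  positivity

lemma densityRatio_mul_le_regCoefCondDensity (hζ : 0 < ζ) (hR : 0 < R) (hω0 : ∀ i, 0 ≤ ω i)
    (hω : ∀ i, ω i ≤ 1 / 2) (hl : ∀ j, R ≤ τ * l j) (β : Fin p → ℝ) :
    densityRatio X y ζ R * gaussianDensity (refMean X y ζ R) (refPrecision X ζ R)⁻¹ β
      ≤ regCoefCondDensity X y ζ τ ω l β := by
  refine mul_gaussianDensity_le (isHermitian_condPrecision ..) ?_ (inv_pos.mpr (pow_pos hζ 2))
    (mul_dotProduct_le_condPrecision X hω0) (fun x => ?_) (score X y) β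
  · rw [refPrecision_eq_condPrecision]
    exact isHermitian_condPrecision ..
  · rw [refPrecision_eq_condPrecision, dotProduct_condPrecision_mulVec,
      dotProduct_condPrecision_mulVec]
    have hl' : ∀ j, (τ ^ 2 * l j ^ 2)⁻¹ ≤ (R ^ 2 * 1 ^ 2)⁻¹ := fun j => by
      rw [one_pow, mul_one, ← mul_pow]
      exact inv_anti₀ (by positivity) (pow_le_pow_left₀ hR.le (hl j) 2)
    refine add_le_add (add_le_add ?_ le_rfl) ?_
    · exact Finset.sum_le_sum fun i _ => mul_le_mul_of_nonneg_right (hω i) (sq_nonneg _)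
    · exact Finset.sum_le_sum fun j _ => mul_le_mul_of_nonneg_right (hl' j) (sq_nonneg _)

end Precision

/-! ### The conditional law of a local scale -/

section LocalScale

variable {πloc : ℝ → ℝ} {b τ u v a : ℝ}

/-- The unnormalized conditional density of a local scale, as a function of the ratio `u = b / τ`
alone: a factor `τ⁻¹`, which cancels in the normalization, is dropped. -/
noncomputable def scaleWeight (πloc : ℝ → ℝ) (u l : ℝ) : ENNReal :=
  ENNReal.ofReal (l⁻¹ * Real.exp (-(u ^ 2 / (2 * l ^ 2))) * πloc l)

/-- The conditional probability that a local scale exceeds `a`, given `β* = u τ`. -/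
noncomputable def scaleTail (πloc : ℝ → ℝ) (u a : ℝ) : ENNReal :=
  (∫⁻ l in Set.Ioi a, scaleWeight πloc u l) / ∫⁻ l in Set.Ioi 0, scaleWeight πloc u l

@[fun_prop]
lemma measurable_scaleWeight (hπ : Measurable πloc) (u : ℝ) :
    Measurable (scaleWeight πloc u) := by
  unfold scaleWeight
  fun_prop

lemma ofReal_localScaleWeight (hτ : 0 < τ) (b l : ℝ) :
    ENNReal.ofReal (localScaleWeight πloc b τ l)
      = ENNReal.ofReal τ⁻¹ * scaleWeight πloc (b / τ) l := by
  rw [scaleWeight, ← ENNReal.ofReal_mul (by positivity), localScaleWeight]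
  congr 1
  rw [mul_inv, div_pow, div_div, mul_left_comm (τ ^ 2), ← mul_assoc 2]
  ring

lemma localScaleCondDensity_eq (hπ : Measurable πloc) (hτ : 0 < τ) (b l : ℝ) :
    localScaleCondDensity πloc b τ l
      = scaleWeight πloc (b / τ) l / ∫⁻ l in Set.Ioi 0, scaleWeight πloc (b / τ) l := by
  simp_rw [localScaleCondDensity, ofReal_localScaleWeight hτ]
  rw [lintegral_const_mul _ (measurable_scaleWeight hπ _),
    ENNReal.mul_div_mul_left _ _ (by simpa using hτ) ENNReal.ofReal_ne_top]

lemma setLIntegral_localScaleCondDensity (hπ : Measurable πloc) (hτ : 0 < τ) (b a : ℝ) :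
    ∫⁻ l in Set.Ioi a, localScaleCondDensity πloc b τ l = scaleTail πloc (b / τ) a := by
  simp_rw [localScaleCondDensity_eq hπ hτ, div_eq_mul_inv, scaleTail]
  rw [lintegral_mul_const _ (measurable_scaleWeight hπ _), div_eq_mul_inv]

lemma measurable_localScaleCondDensity (hπ : Measurable πloc) (hτ : 0 < τ) (b : ℝ) :
    Measurable (localScaleCondDensity πloc b τ) := by
  rw [funext (localScaleCondDensity_eq hπ hτ b)]
  exact (measurable_scaleWeight hπ _).div_const _

lemma setLIntegral_scaleWeight_pos (hπ : IsLocalScalePrior πloc)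
    (hunbdd : 0 < ∫⁻ l in Set.Ioi a, ENNReal.ofReal (πloc l)) (ha : 0 ≤ a) (u : ℝ) :
    0 < ∫⁻ l in Set.Ioi a, scaleWeight πloc u l := by
  rw [pos_iff_ne_zero] at hunbdd ⊢
  have hm := measurable_scaleWeight hπ.measurable u
  have hm' := hπ.measurable
  contrapose! hunbdd
  rw [lintegral_eq_zero_iff hm] at hunbdd
  rw [lintegral_eq_zero_iff (by fun_prop)]
  filter_upwards [hunbdd, ae_restrict_mem measurableSet_Ioi] with l hl hla
  have hl0 : 0 < l := ha.trans_lt hla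
  simp only [scaleWeight, Pi.zero_apply, ENNReal.ofReal_eq_zero] at hl ⊢
  by_contra! h
  exact absurd hl (not_le.mpr (by positivity))

/-- For `u ≠ 0` the factor `l⁻¹ exp(-u² / (2 l²))` is bounded, so the conditional density of a local
scale is normalizable. -/
lemma setLIntegral_scaleWeight_lt_top (hπ : IsLocalScalePrior πloc) (hu : u ≠ 0) :
    ∫⁻ l in Set.Ioi 0, scaleWeight πloc u l < ⊤ := by
  have hbound : ∀ l ∈ Set.Ioi (0 : ℝ),
      scaleWeight πloc u l ≤ ENNReal.ofReal (1 + 2 / u ^ 2) * ENNReal.ofReal (πloc l) := by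
    intro l hl
    have hl : 0 < l := hl
    rw [scaleWeight, ← ENNReal.ofReal_mul (by positivity)]
    refine ENNReal.ofReal_le_ofReal (mul_le_mul_of_nonneg_right ?_ (hπ.nonneg l hl))
    -- `exp(-x) ≤ 1 / x` with `x = u² / (2 l²)` bounds the factor by `2 l / u²`, useful for `l ≤ 1`
    have hx : 0 < u ^ 2 / (2 * l ^ 2) := by positivity
    have hexp : Real.exp (-(u ^ 2 / (2 * l ^ 2))) ≤ (u ^ 2 / (2 * l ^ 2))⁻¹ := by
      rw [Real.exp_neg]
      exact inv_anti₀ hx (by linarith [Real.add_one_le_exp (u ^ 2 / (2 * l ^ 2))])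
    have hu2 : 0 < u ^ 2 := by positivity
    rcases le_total l 1 with h1 | h1
    · calc l⁻¹ * Real.exp (-(u ^ 2 / (2 * l ^ 2))) ≤ l⁻¹ * (u ^ 2 / (2 * l ^ 2))⁻¹ := by gcongr
        _ = 2 / u ^ 2 * l := by field_simp
        _ ≤ 2 / u ^ 2 * 1 := by gcongr
        _ ≤ 1 + 2 / u ^ 2 := by linarith
    · calc l⁻¹ * Real.exp (-(u ^ 2 / (2 * l ^ 2))) ≤ 1 * 1 := by
            gcongr
            · exact inv_le_one_of_one_le₀ h1
            · exact Real.exp_le_one_iff.mpr (by linarith)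
        _ ≤ 1 + 2 / u ^ 2 := by
            have : 0 < 2 / u ^ 2 := by positivity
            linarith
  have hm' := hπ.measurable
  calc _ ≤ ∫⁻ l in Set.Ioi 0, ENNReal.ofReal (1 + 2 / u ^ 2) * ENNReal.ofReal (πloc l) :=
        setLIntegral_mono' measurableSet_Ioi hbound
    _ = ENNReal.ofReal (1 + 2 / u ^ 2) := by
        rw [lintegral_const_mul _ (by fun_prop), hπ.lintegral_eq_one, mul_one]
    _ < ⊤ := ENNReal.ofReal_lt_top

/-- The conditional law of a local scale is stochastically increasing in `|u|`: the likelihood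
ratio `exp(-(v² - u²) / (2 l²))` increases with `l`, so it is at most its value `t` at `a` on
`(0, a]` and at least `t` on `(a, ∞)`. -/
lemma scaleTail_mono_left (hπ : IsLocalScalePrior πloc)
    (hfin : ∫⁻ l in Set.Ioi 0, scaleWeight πloc u l < ⊤)
    (hunbdd : ∀ a : ℝ, 0 < a → 0 < ∫⁻ l in Set.Ioi a, ENNReal.ofReal (πloc l))
    (ha : 0 < a) (huv : |u| ≤ |v|) :
    scaleTail πloc u a ≤ scaleTail πloc v a := by
  have huv2 : 0 ≤ v ^ 2 - u ^ 2 := sub_nonneg.mpr (sq_le_sq.mpr huv)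
  have hratio : ∀ l, scaleWeight πloc v l
      = ENNReal.ofReal (Real.exp (-((v ^ 2 - u ^ 2) / (2 * l ^ 2)))) * scaleWeight πloc u l := by
    intro l
    rw [scaleWeight, scaleWeight, ← ENNReal.ofReal_mul (Real.exp_nonneg _)]
    congr 1
    rw [sub_div, neg_sub, show -(v ^ 2 / (2 * l ^ 2)) = (u ^ 2 / (2 * l ^ 2) - v ^ 2 / (2 * l ^ 2))
      + -(u ^ 2 / (2 * l ^ 2)) by ring, Real.exp_add]
    ring
  set t := ENNReal.ofReal (Real.exp (-((v ^ 2 - u ^ 2) / (2 * a ^ 2)))) with ht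
  have hsplit : ∀ w, ∫⁻ l in Set.Ioi 0, scaleWeight πloc w l
      = (∫⁻ l in Set.Ioc 0 a, scaleWeight πloc w l) + ∫⁻ l in Set.Ioi a, scaleWeight πloc w l := by
    intro w
    rw [← Set.Ioc_union_Ioi_eq_Ioi ha.le, lintegral_union measurableSet_Ioi
      (Set.Ioc_disjoint_Ioi le_rfl)]
  have hlow : ∫⁻ l in Set.Ioc 0 a, scaleWeight πloc v l
      ≤ t * ∫⁻ l in Set.Ioc 0 a, scaleWeight πloc u l := by
    rw [← lintegral_const_mul _ (measurable_scaleWeight hπ.measurable u)]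
    refine setLIntegral_mono' measurableSet_Ioc fun l hl => ?_
    have := hl.1
    have := hl.2
    rw [hratio, ht]
    gcongr
  have hhigh : t * ∫⁻ l in Set.Ioi a, scaleWeight πloc u l
      ≤ ∫⁻ l in Set.Ioi a, scaleWeight πloc v l := by
    rw [← lintegral_const_mul _ (measurable_scaleWeight hπ.measurable u)]
    refine setLIntegral_mono' measurableSet_Ioi fun l hl => ?_
    have : a ≤ l := le_of_lt hl
    rw [hratio, ht]
    gcongr
  have hNv := setLIntegral_scaleWeight_pos hπ (hunbdd a ha) ha.le v
  -- finiteness at `v` follows from that at `u`; it is needed because `⊤ / ⊤ = 0` in `ENNReal`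
  have hDv : ∫⁻ l in Set.Ioi 0, scaleWeight πloc v l < ⊤ := by
    refine lt_of_le_of_lt (lintegral_mono fun l => ?_) hfin
    rw [hratio]
    refine mul_le_of_le_one_left zero_le (ENNReal.ofReal_le_one.mpr ?_)
    exact Real.exp_le_one_iff.mpr (neg_nonpos.mpr (by positivity))
  unfold scaleTail
  rw [hsplit] at hDv
  rw [hsplit u, hsplit v]
  refine ENNReal.div_le_of_le_mul ?_
  rw [← ENNReal.mul_div_right_comm, ENNReal.le_div_iff_mul_le
    (Or.inl (hNv.trans_le le_add_self).ne') (Or.inl hDv.ne), mul_add, mul_add]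
  refine add_le_add ?_ (mul_comm _ _).le
  calc _ ≤ (∫⁻ l in Set.Ioi a, scaleWeight πloc u l) *
          (t * ∫⁻ l in Set.Ioc 0 a, scaleWeight πloc u l) := by gcongr
    _ = t * (∫⁻ l in Set.Ioi a, scaleWeight πloc u l) *
          ∫⁻ l in Set.Ioc 0 a, scaleWeight πloc u l := by ring
    _ ≤ _ := by gcongr

lemma scaleTail_pos (hπ : IsLocalScalePrior πloc)
    (hfin : ∫⁻ l in Set.Ioi 0, scaleWeight πloc u l < ⊤)
    (hunbdd : 0 < ∫⁻ l in Set.Ioi a, ENNReal.ofReal (πloc l)) (ha : 0 ≤ a) :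
    0 < scaleTail πloc u a :=
  ENNReal.div_pos (setLIntegral_scaleWeight_pos hπ hunbdd ha u).ne' hfin.ne

lemma scaleTail_le_one (ha : 0 ≤ a) : scaleTail πloc u a ≤ 1 :=
  (ENNReal.div_le_div_right (lintegral_mono_set (Set.Ioi_subset_Ioi ha)) _).trans
    ENNReal.div_self_le_one

lemma scaleTail_anti_right {a' : ℝ} (h : a' ≤ a) : scaleTail πloc u a ≤ scaleTail πloc u a' :=
  ENNReal.div_le_div_right (lintegral_mono_set (Set.Ioi_subset_Ioi h)) _

end LocalScale

/-! ### Minorization of the transition kernel -/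

/-- **Tonelli's theorem** for a product of functions of separate coordinates. -/
lemma lintegral_fin_prod_eq_prod {p : ℕ} {μ : Measure ℝ} [SigmaFinite μ]
    {f : Fin p → ℝ → ENNReal} (hf : ∀ i, Measurable (f i)) :
    ∫⁻ x : Fin p → ℝ, ∏ i, f i (x i) ∂Measure.pi (fun _ => μ) = ∏ i, ∫⁻ x, f i x ∂μ := by
  induction p with
  | zero => simp
  | succ p ih =>
    rw [← ((measurePreserving_piFinSuccAbove (fun _ : Fin (p + 1) => μ) 0).symm).lintegral_comp_emb
      (MeasurableEquiv.measurableEmbedding _)]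
    simp_rw [MeasurableEquiv.piFinSuccAbove_symm_apply, Fin.insertNthEquiv,
      Fin.prod_univ_succ, Fin.insertNth_zero, Equiv.coe_fn_mk, Fin.cons_succ, Fin.cons_zero]
    rw [← ih (f := fun i : Fin p => f i.succ) fun i => hf i.succ]
    exact lintegral_prod_mul (hf 0).aemeasurable
      (Finset.measurable_prod _ fun i _ =>
        (hf (Fin.succ i)).comp (measurable_pi_apply i)).aemeasurable

section Minorization

variable {n p : ℕ} (X : Matrix (Fin n) (Fin p) ℝ) (y : Fin n → ℝ) {ζ τ R : ℝ}

/-- The lower bound for the transition density given local scales `l` with `R ≤ τ l`, relative to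
the reference Gaussian density. -/
noncomputable def kernelConst (ζ R : ℝ) : ℝ := densityRatio X y ζ R * (1 / 2) ^ n

lemma kernelConst_pos (hζ : 0 < ζ) : 0 < kernelConst X y ζ R :=
  mul_pos (densityRatio_pos X y hζ) (by positivity)

lemma kernelConst_mul_le_kernelGivenScales (hζ : 0 < ζ) (hR : 0 < R) {l : Fin p → ℝ}
    (hl : ∀ j, R ≤ τ * l j) (βs β : Fin p → ℝ) :
    ENNReal.ofReal (kernelConst X y ζ R *
        gaussianDensity (refMean X y ζ R) (refPrecision X ζ R)⁻¹ β)
      ≤ kernelGivenScales X y ζ τ l βs β := by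
  set S : Set (Fin n → ℝ) := Set.univ.pi fun _ => Set.Icc 0 (1 / 2)
  have hS : MeasurableSet S := MeasurableSet.univ_pi fun _ => measurableSet_Icc
  set d := densityRatio X y ζ R * gaussianDensity (refMean X y ζ R) (refPrecision X ζ R)⁻¹ β
  calc _ = ENNReal.ofReal d * 2⁻¹ ^ n := by
        rw [kernelConst, mul_right_comm, ENNReal.ofReal_mul' (by positivity),
          ENNReal.ofReal_pow (by norm_num), one_div, ENNReal.ofReal_inv_of_pos two_pos,
          ENNReal.ofReal_ofNat]
    _ ≤ ENNReal.ofReal d * omegaCondMeasure X βs S := by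
        gcongr
        exact half_pow_le_omegaCondMeasure X βs
    _ = ∫⁻ _ω in S, ENNReal.ofReal d ∂omegaCondMeasure X βs := (setLIntegral_const S _).symm
    _ ≤ ∫⁻ ω in S, ENNReal.ofReal (regCoefCondDensity X y ζ τ ω l β) ∂omegaCondMeasure X βs :=
        setLIntegral_mono' hS fun ω hω => ENNReal.ofReal_le_ofReal
          (densityRatio_mul_le_regCoefCondDensity X y hζ hR (fun i => (hω i trivial).1)
            (fun i => (hω i trivial).2) hl β)
    _ ≤ _ := setLIntegral_le_lintegral S _

lemma mul_prod_scaleTail_le_marginalKernel {πloc : ℝ → ℝ} (hπ : Measurable πloc) (hζ : 0 < ζ)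
    (hR : 0 < R) (hτ : 0 < τ) (βs β : Fin p → ℝ) :
    ENNReal.ofReal (kernelConst X y ζ R *
        gaussianDensity (refMean X y ζ R) (refPrecision X ζ R)⁻¹ β)
        * ∏ j, scaleTail πloc (βs j / τ) (R / τ)
      ≤ marginalKernel X y ζ πloc τ βs β := by
  set d := ENNReal.ofReal (kernelConst X y ζ R *
    gaussianDensity (refMean X y ζ R) (refPrecision X ζ R)⁻¹ β)
  have hm := fun j => measurable_localScaleCondDensity hπ hτ (βs j)
  have hT : MeasurableSet (Set.univ.pi fun _ : Fin p => Set.Ioi (R / τ)) :=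
    MeasurableSet.univ_pi fun _ => measurableSet_Ioi
  calc d * ∏ j, scaleTail πloc (βs j / τ) (R / τ)
      = d * ∫⁻ l in Set.univ.pi fun _ : Fin p => Set.Ioi (R / τ),
          ∏ j, localScaleCondDensity πloc (βs j) τ (l j) := by
        rw [volume_pi, Measure.restrict_pi_pi, lintegral_fin_prod_eq_prod hm]
        simp_rw [setLIntegral_localScaleCondDensity hπ hτ]
    _ = ∫⁻ l in Set.univ.pi fun _ : Fin p => Set.Ioi (R / τ),
          d * ∏ j, localScaleCondDensity πloc (βs j) τ (l j) :=
        (lintegral_const_mul _ (Finset.measurable_prod _ fun j _ =>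
          (hm j).comp (measurable_pi_apply j))).symm
    _ ≤ ∫⁻ l in Set.univ.pi fun _ : Fin p => Set.Ioi (R / τ),
          kernelGivenScales X y ζ τ l βs β * ∏ j, localScaleCondDensity πloc (βs j) τ (l j) := by
        refine setLIntegral_mono' hT fun l hl => ?_
        gcongr
        refine kernelConst_mul_le_kernelGivenScales X y hζ hR (fun j => ?_) βs β
        have hlj : R / τ < l j := hl j trivial
        rw [div_lt_iff₀' hτ] at hlj
        exact hlj.le
    _ ≤ _ := lintegral_mono_set
        (Set.pi_mono fun _ _ => Set.Ioi_subset_Ioi (by positivity))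

/-- Minorization for all `β*` with `|β*ⱼ / τ| ≥ u`, provided the conditional law of a local scale at
ratio `u` is normalizable. The two halves of the theorem are the cases `u = ε` and `u = 0`. -/
lemma exists_minorization {πloc : ℝ → ℝ} (hπ : IsLocalScalePrior πloc) (hζ : 0 < ζ)
    (hunbdd : ∀ a : ℝ, 0 < a → 0 < ∫⁻ l in Set.Ioi a, ENNReal.ofReal (πloc l))
    (hR : 0 < R) {u : ℝ} (hu : 0 ≤ u) (hfin : ∫⁻ l in Set.Ioi 0, scaleWeight πloc u l < ⊤) :
    ∃ δ : ℝ → ℝ, (∀ τ, 0 < τ → 0 < δ τ) ∧ StrictMonoOn δ (Set.Ioi 0) ∧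
      ∀ τ : ℝ, 0 < τ → ∀ βs : Fin p → ℝ, (∀ j, u ≤ |βs j / τ|) → ∀ β : Fin p → ℝ,
        ENNReal.ofReal (δ τ * gaussianDensity (refMean X y ζ R) (refPrecision X ζ R)⁻¹ β)
          ≤ marginalKernel X y ζ πloc τ βs β := by
  have hC := kernelConst_pos X y (R := R) hζ
  have htop : ∀ τ, 0 < τ → scaleTail πloc u (R / τ) ≠ ⊤ := fun τ hτ =>
    ((scaleTail_le_one (by positivity)).trans_lt ENNReal.one_lt_top).ne
  set q : ℝ → ℝ := fun τ => (scaleTail πloc u (R / τ)).toReal with hq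
  have hq0 : ∀ τ, 0 < τ → 0 < q τ := fun τ hτ =>
    ENNReal.toReal_pos (scaleTail_pos hπ hfin (hunbdd _ (by positivity)) (by positivity)).ne'
      (htop τ hτ)
  -- the factor `τ / (1 + τ) < 1` only serves to make a nondecreasing bound strictly increasing
  refine ⟨fun τ => τ / (1 + τ) * (kernelConst X y ζ R * q τ ^ p), fun τ hτ => ?_, ?_, ?_⟩
  · have := hq0 τ hτ
    positivity
  · intro s hs t ht hst
    have hs : 0 < s := hs
    have ht : 0 < t := ht
    have hqst : q s ≤ q t := ENNReal.toReal_mono (htop t ht) (scaleTail_anti_right (by gcongr))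
    have := hq0 s hs
    refine mul_lt_mul ?_ (by gcongr) (by positivity) (by positivity)
    rw [div_lt_div_iff₀ (by positivity) (by positivity)]
    linarith
  · intro τ hτ βs hβs β
    refine le_trans ?_ (mul_prod_scaleTail_le_marginalKernel X y hπ.measurable hζ hR hτ βs β)
    set g := gaussianDensity (refMean X y ζ R) (refPrecision X ζ R)⁻¹ β with hg
    have hg0 : 0 ≤ g := by
      rw [hg, gaussianDensity]
      positivity
    have hq0' := hq0 τ hτ
    calc ENNReal.ofReal (τ / (1 + τ) * (kernelConst X y ζ R * q τ ^ p) * g)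
        ≤ ENNReal.ofReal (kernelConst X y ζ R * g * q τ ^ p) := by
          refine ENNReal.ofReal_le_ofReal ?_
          have h1 : τ / (1 + τ) ≤ 1 := (div_le_one (by positivity)).mpr (by linarith)
          calc _ = τ / (1 + τ) * (kernelConst X y ζ R * g * q τ ^ p) := by ring
            _ ≤ _ := mul_le_of_le_one_left (by positivity) h1
      _ = ENNReal.ofReal (kernelConst X y ζ R * g) * ∏ _j : Fin p, scaleTail πloc u (R / τ) := by
          rw [ENNReal.ofReal_mul (by positivity), ENNReal.ofReal_pow hq0'.le, hq,
            ENNReal.ofReal_toReal (htop τ hτ)]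
          simp
      _ ≤ _ := by
          gcongr with j _
          exact scaleTail_mono_left hπ hfin hunbdd (by positivity)
            (by rw [abs_of_nonneg hu]; exact hβs j)

end Minorization

end SparseLogit

theorem mainTheorem6 {n p : ℕ} (X : Matrix (Fin n) (Fin p) ℝ) (y : Fin n → ℝ)
    (hy : ∀ i, y i = 0 ∨ y i = 1) (ζ : ℝ) (hζ : 0 < ζ)
    (πloc : ℝ → ℝ) (hπ : SparseLogit.IsLocalScalePrior πloc)
    (hπ_unbdd : ∀ a : ℝ, 0 < a → 0 < ∫⁻ l in Set.Ioi a, ENNReal.ofReal (πloc l))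
    (R : ℝ) (hR : 0 < R) :
    (∀ ε : ℝ, 0 < ε →
      ∃ δ : ℝ → ℝ, (∀ τ, 0 < τ → 0 < δ τ) ∧ StrictMonoOn δ (Set.Ioi 0) ∧
        ∀ τ : ℝ, 0 < τ → ∀ βs : Fin p → ℝ, (∀ j, ε ≤ |βs j / τ|) → ∀ β : Fin p → ℝ,
          ENNReal.ofReal (δ τ * SparseLogit.gaussianDensity (SparseLogit.refMean X y ζ R)
              (SparseLogit.refPrecision X ζ R)⁻¹ β)
            ≤ SparseLogit.marginalKernel X y ζ πloc τ βs β) ∧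
    (∫⁻ l in Set.Ioi (0 : ℝ), ENNReal.ofReal (l⁻¹ * πloc l) < ⊤ →
      ∃ δ : ℝ → ℝ, (∀ τ, 0 < τ → 0 < δ τ) ∧ StrictMonoOn δ (Set.Ioi 0) ∧
        ∀ τ : ℝ, 0 < τ → ∀ βs β : Fin p → ℝ,
          ENNReal.ofReal (δ τ * SparseLogit.gaussianDensity (SparseLogit.refMean X y ζ R)
              (SparseLogit.refPrecision X ζ R)⁻¹ β)
            ≤ SparseLogit.marginalKernel X y ζ πloc τ βs β) := by
  refine ⟨fun ε hε => SparseLogit.exists_minorization X y hπ hζ hπ_unbdd hR hε.le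
    (SparseLogit.setLIntegral_scaleWeight_lt_top hπ hε.ne'), fun hint => ?_⟩
  obtain ⟨δ, hpos, hmono, h⟩ := SparseLogit.exists_minorization X y hπ hζ hπ_unbdd hR le_rfl
    (by simpa [SparseLogit.scaleWeight] using hint)
  exact ⟨δ, hpos, hmono, fun τ hτ βs β => h τ hτ βs (fun j => abs_nonneg _) β⟩
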